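/- Let $X$ be a random real $m\times k$ matrix with columns $u_1,\dots,u_k$. For a vector $x\in\mathbb{R}^m$ write $|x|=\sum_r x_r$ (its size) and $\|x\|$ for the Euclidean norm. Let $w_j=E(\|u_j\|^2)$, let $G=E(X^TX)$ be the expected Gram matrix, let $\sigma_1(G)\ge\dots\ge\sigma_k(G)$ be its singular values, let $\tau$ be a permutation of $\{1,\dots,k\}$ with $w_{\tau(1)}\ge\dots\ge w_{\tau(k)}$, and let $L$ be the (essential) maximum of the number of non-zero entries in a column of $X$. For column sizes $s=(s_1,\dots,s_k)$ put $C=\max_j s_j$ and $\xi_j=s_j/w_j$. Call $X$ *admissible for $s$* if * ($S_2'$) the columns of $X$ have fixed sizes $|u_j|=s_j$ almost surely, are (almost surely) non-negative, independent, and invariant under the group $\Gamma_m$ of permutations of coordinates, in the sense that $E\langle gv,u_j\rangle=E\langle v,u_j\rangle$ for all $v\in\mathbb{R}^m$, $g\in\Gamma_m$; * ($S_1$) almost surely $\|u_j\|^2\ge |u_j|$ for all $j$; $C\le m$; and $$\frac{\sqrt{\frac1k\sum_j\xi_j^2}}{\frac1k\sum_j\xi_j}\le 1+\frac{m}{Ck};$$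 * $\dfrac1k\le\dfrac Lm$. Let $\alpha\ge1$, $0<\beta\le 1/\sqrt k$, and let the column sizes $s_1,\dots,s_k$ be an independent sample from the gamma distribution with density proportional to $t^{\alpha-1}e^{-\beta t}$ left-truncated at $1$ (i.e. restricted to $[1,\infty)$ and normalized). Then with high probability $$\Bigl(1+\sqrt{1+1/\alpha}+O(L/m)\Bigr)^{-1}w_{\tau(i)}\;\le\;\sigma_i(G)\;\le\;\Bigl(1+\frac{k}{m\beta}\sqrt{\alpha(\alpha+1)}+O(L/m)\Bigr)w_{\tau(i)},\qquad i=1,\dots,k .$$ Precisely: there are absolute constants $K\ge0$ and $\eta>0$ such that for every $\varepsilon>0$ there is $k_0$ such that for all $k\ge k_0$, all $\alpha\ge1$ and all $0<\beta\le1/\sqrt k$, there is a measurable set of size vectors $s$, of probability at least $1-\varepsilon$ for the sample, such that for every $s$ in this set, every $m$, and every random $m\times k$ matrix $X$ admissible for $s$ with $L/m\le\eta$, every such $\tau$ and all $i$, the two inequalities hold with $O(L/m)$ replaced by $K\,L/m$. -/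

import Mathlib

open MeasureTheory ProbabilityTheory

noncomputable section

namespace SparseGram

/-- The size of a (non-negative) vector: the sum of its coordinates. -/
def size {m : ℕ} (x : Fin m → ℝ) : ℝ := ∑ i, x i

/-- The squared Euclidean norm of a vector. -/
def normSq {m : ℕ} (x : Fin m → ℝ) : ℝ := ∑ i, x i ^ 2

/-- The number of non-zero entries of a vector. -/
def numNonzero {m : ℕ} (x : Fin m → ℝ) : ℕ := Set.ncard {i | x i ≠ 0}

/-- The sample moment ratio of a finite sequence: the square root of its second sample moment
divided by its sample mean. -/
def sampleMomentRatio {k : ℕ} (a : Fin k → ℝ) : ℝ :=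
  √((1 / (k : ℝ)) * ∑ i, a i ^ 2) / ((1 / (k : ℝ)) * ∑ i, a i)

section RandomMatrix

variable {Ω : Type*} [MeasurableSpace Ω] {m k : ℕ}

/-- The `j`-th column of a random matrix, as a random vector. -/
def col (X : Ω → Matrix (Fin m) (Fin k) ℝ) (j : Fin k) : Ω → Fin m → ℝ := fun ω i => X ω i j

/-- Invariance of a random vector under the group of permutations of coordinates: the expectation
`E ⟨g v, x⟩` does not depend on the permutation `g`. -/
def PermInvariant (P : Measure Ω) (x : Ω → Fin m → ℝ) : Prop :=
  ∀ (g : Equiv.Perm (Fin m)) (v : Fin m → ℝ),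
    ∫ ω, ∑ i, v (g i) * x ω i ∂P = ∫ ω, ∑ i, v i * x ω i ∂P

/-- The expected squared column norms `w_j = E ‖u_j‖²`. -/
def expNormSq (P : Measure Ω) (X : Ω → Matrix (Fin m) (Fin k) ℝ) (j : Fin k) : ℝ :=
  ∫ ω, normSq (col X j ω) ∂P

/-- The expected Gram matrix `G = E (Xᵀ X)` (entrywise expectation). -/
def expGram (P : Measure Ω) (X : Ω → Matrix (Fin m) (Fin k) ℝ) : Matrix (Fin k) (Fin k) ℝ :=
  Matrix.of fun i j => ∫ ω, ((X ω).transpose * X ω) i j ∂P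

/-- `L`: the (essential) maximum, over the columns and over the outcomes, of the number of
non-zero entries in a column. -/
def maxNonzero (P : Measure Ω) (X : Ω → Matrix (Fin m) (Fin k) ℝ) : ℕ :=
  sInf {l : ℕ | ∀ᵐ ω ∂P, ∀ j, numNonzero (col X j ω) ≤ l}

/-- Condition `(S₁)` for a random matrix with fixed column sizes `s`; here `ξ_j = s_j / w_j` and
`C = max_j s_j`. -/
structure CondS1 (P : Measure Ω) (X : Ω → Matrix (Fin m) (Fin k) ℝ) (s : Fin k → ℝ) : Prop where
  size_le_normSq : ∀ᵐ ω ∂P, ∀ j, size (col X j ω) ≤ normSq (col X j ω)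
  maxSize_le : (⨆ j, s j) ≤ m
  momentRatio_le : sampleMomentRatio (fun j => s j / expNormSq P X j) ≤ 1 + m / ((⨆ j, s j) * k)

/-- Condition `(S₂')`: the columns are independent non-negative random vectors, invariant under
permutations of coordinates, with fixed sizes `s`. -/
structure CondS2 (P : Measure Ω) (X : Ω → Matrix (Fin m) (Fin k) ℝ) (s : Fin k → ℝ) : Prop where
  measurable : ∀ j, Measurable (col X j)
  size_eq : ∀ᵐ ω ∂P, ∀ j, size (col X j ω) = s j
  nonneg : ∀ᵐ ω ∂P, ∀ i j, 0 ≤ X ω i j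
  indep : iIndepFun (fun j => col X j) P
  invariant : ∀ j, PermInvariant P (col X j)

end RandomMatrix

/-- The singular values of a real square matrix in descending order (numbered from `0`). -/
def singularValue {k : ℕ} (A : Matrix (Fin k) (Fin k) ℝ) (i : Fin k) : ℝ :=
  (Matrix.toEuclideanLin A).singularValues i

/-- The gamma distribution with shape `α` and rate `β`, left-truncated at `a`. -/
def truncGamma (a α β : ℝ) : Measure ℝ := cond (gammaMeasure α β) (Set.Ici a)

/-- The law of a sample of `k` independent column sizes from the gamma distribution left-truncated
at `1`. -/
def sizeLaw (k : ℕ) (α β : ℝ) : Measure (Fin k → ℝ) := Measure.pi fun _ => truncGamma 1 α β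

end SparseGram

end

/-! ### Courant–Fischer bounds for positive operators -/

section MinMax

open Module

variable {k : ℕ}

/-! Independence and permutation invariance make every off-diagonal entry of `G` equal to `s i * s j
/ m`, so `G = diag(w_j - s_j² / m) + s sᵀ / m` (`CondS2.inner_expGram`). Cauchy–Schwarz on the
support of a column gives `s_j² ≤ L w_j`. Dropping the rank one term therefore leaves `G ≥ (1 - L/m)
diag(w)`, and min-max gives the lower bound (`CondS2.le_singularValue`).

For the upper bound, min-max on the coordinates `τ i, τ (i + 1), …` reduces the claim to bounding
`(∑ s_j x_j)²` there by `k R w_{τ i} ‖x‖²`, where `R = √(α(α+1))/β` is the root mean square of the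
gamma law. `CondS2.singularValue_le_of_sum_sq_le` does this by a dichotomy, assuming that `∑ s_j²`
barely exceeds `k R²` and that a fixed fraction of the sizes exceeds `R` by a larger margin. If a
large size remains in the tail, then `w_{τ i}` itself exceeds `R` by enough to absorb the excess in
`∑ s_j²`. Otherwise all large sizes come before `i`, and the shortened tail has `∑ s_j ≤ k R`.

Both assumptions hold with high probability, uniformly in `α`, because both margins are multiples of
the relative standard deviation of `x²`: Chebyshev controls `∑ s_j²`, and a bounded kurtosis forces
upward deviations of that order (`le_measureReal_of_kurtosis_le`). Truncation at `1` matters little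
since `β` is small. No error term in `L/m` is needed in the end. -/

/-- Two orthonormal bases: some non-zero vector has vanishing coordinates after `i` in the first
one and before `i` in the second one. -/
lemma exists_ne_zero_repr_eq_zero {E : Type*} [NormedAddCommGroup E] [InnerProductSpace ℝ E]
    (b b' : OrthonormalBasis (Fin k) ℝ E) (i : Fin k) :
    ∃ x : E, x ≠ 0 ∧ (∀ l, i < l → b.repr x l = 0) ∧ ∀ l, l < i → b'.repr x l = 0 := by
  have : FiniteDimensional ℝ E := b.toBasis.finiteDimensional_of_finite
  -- One linear condition for each `l ≠ i` makes `k - 1` conditions in dimension `k`, so the kernel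
  -- is non-trivial.
  let f : E →ₗ[ℝ] ({l : Fin k // l ≠ i} → ℝ) :=
    LinearMap.pi fun l => if l.1 < i
      then (EuclideanSpace.proj l.1).toLinearMap ∘ₗ b'.repr.toLinearEquiv.toLinearMap
      else (EuclideanSpace.proj l.1).toLinearMap ∘ₗ b.repr.toLinearEquiv.toLinearMap
  have hlt : finrank ℝ ({l : Fin k // l ≠ i} → ℝ) < finrank ℝ E := by
    rw [finrank_pi, finrank_eq_card_basis b.toBasis]
    simpa using i.pos
  obtain ⟨x, hx, hx0⟩ := Submodule.exists_mem_ne_zero_of_ne_bot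
    (LinearMap.ker_ne_bot_of_finrank_lt hlt (f := f))
  have hf : ∀ l : {l : Fin k // l ≠ i}, f x l = 0 := fun l => by
    rw [LinearMap.mem_ker.1 hx]; rfl
  refine ⟨x, hx0, fun l hl => ?_, fun l hl => ?_⟩
  · have := hf ⟨l, hl.ne'⟩
    simpa [f, not_lt.2 hl.le] using this
  · have := hf ⟨l, hl.ne⟩
    simpa [f, hl] using this

/-- An eigenbasis of `T* T = T²` already diagonalises `T`, since positivity excludes the eigenvalue
`-σ` when `σ > 0`. -/
lemma LinearMap.IsPositive.exists_orthonormalBasis_singularValues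
    {E : Type*} [NormedAddCommGroup E] [InnerProductSpace ℝ E] [FiniteDimensional ℝ E]
    {T : E →ₗ[ℝ] E} (hT : T.IsPositive) (hn : finrank ℝ E = k) :
    ∃ b : OrthonormalBasis (Fin k) ℝ E, ∀ l : Fin k, T (b l) = T.singularValues l • b l := by
  refine ⟨T.isSymmetric_adjoint_comp_self.eigenvectorBasis hn, fun l => ?_⟩
  set v := T.isSymmetric_adjoint_comp_self.eigenvectorBasis hn l
  set σ := T.singularValues l
  have hσ : 0 ≤ σ := T.singularValues_nonneg l
  have hadj : LinearMap.adjoint T = T :=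
    (LinearMap.isSymmetric_iff_isSelfAdjoint T).1 hT.isSymmetric
  have hv : T (T v) = (σ ^ 2) • v := by
    have := T.isSymmetric_adjoint_comp_self.apply_eigenvectorBasis hn l
    rw [← T.sq_singularValues_fin hn, LinearMap.comp_apply] at this
    exact (LinearMap.congr_fun hadj _).symm.trans this
  rcases hσ.eq_or_lt with h0 | hpos
  · rw [← h0] at hv ⊢
    have : inner ℝ (T v) (T v) = (0 : ℝ) := by
      rw [hT.isSymmetric v (T v), hv]; simp
    simpa using this
  -- `(T + σ)(T - σ) v = 0`, so `u` would be an eigenvector for `-σ < 0` unless it vanishes.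
  · set u := T v - σ • v with hu
    have hTu : T u = -(σ • u) := by
      rw [hu, map_sub, map_smul, hv, smul_sub, smul_smul]
      rw [pow_two]; abel
    have h1 := hT.re_inner_nonneg_left u
    rw [hTu, inner_neg_left, inner_smul_left] at h1
    simp only [conj_trivial, real_inner_self_eq_norm_sq, RCLike.re_to_real] at h1
    have : ‖u‖ = 0 := by
      by_contra h
      have : 0 < ‖u‖ := lt_of_le_of_ne (norm_nonneg _) (Ne.symm h)
      have : 0 < σ * ‖u‖ ^ 2 := by positivity
      linarith
    exact sub_eq_zero.1 (norm_eq_zero.1 this)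

lemma OrthonormalBasis.inner_apply_self_eq_sum
    {E : Type*} [NormedAddCommGroup E] [InnerProductSpace ℝ E]
    {T : E →ₗ[ℝ] E} (b : OrthonormalBasis (Fin k) ℝ E) {c : Fin k → ℝ}
    (h : ∀ l, T (b l) = c l • b l) (x : E) :
    inner ℝ (T x) x = ∑ l, c l * b.repr x l ^ 2 := by
  have h1 : T x = ∑ l, (c l * b.repr x l) • b l := by
    conv_lhs => rw [← b.sum_repr x]
    simp [h, smul_smul, mul_comm]
  rw [h1, sum_inner]
  refine Finset.sum_congr rfl fun l _ => ?_
  rw [inner_smul_left, b.repr_apply_apply]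
  simp; ring

lemma OrthonormalBasis.norm_sq_eq_sum
    {E : Type*} [NormedAddCommGroup E] [InnerProductSpace ℝ E]
    (b : OrthonormalBasis (Fin k) ℝ E) (x : E) : ‖x‖ ^ 2 = ∑ l, b.repr x l ^ 2 := by
  rw [← b.repr.norm_map x, EuclideanSpace.norm_sq_eq]
  simp

/-- The coordinate subspace of codimension `i` meets the span of the top `i + 1` singular vectors,
on which the Rayleigh quotient is at least the `i`-th singular value. -/
lemma LinearMap.IsPositive.singularValues_le
    {T : EuclideanSpace ℝ (Fin k) →ₗ[ℝ] EuclideanSpace ℝ (Fin k)}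
    (hT : T.IsPositive) (τ : Equiv.Perm (Fin k)) (i : Fin k) {c : ℝ}
    (h : ∀ x : EuclideanSpace ℝ (Fin k), (∀ j, j < i → x (τ j) = 0) →
      inner ℝ (T x) x ≤ c * ‖x‖ ^ 2) : T.singularValues i ≤ c := by
  obtain ⟨b, hb⟩ := hT.exists_orthonormalBasis_singularValues (k := k) (by simp)
  obtain ⟨x, hx0, hx1, hx2⟩ := exists_ne_zero_repr_eq_zero b
    ((EuclideanSpace.basisFun (Fin k) ℝ).reindex τ.symm) i
  have h1 := h x (fun j hj => by simpa using hx2 j hj)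
  have h2 : T.singularValues i * ‖x‖ ^ 2 ≤ inner ℝ (T x) x := by
    rw [b.inner_apply_self_eq_sum hb, b.norm_sq_eq_sum, Finset.mul_sum]
    refine Finset.sum_le_sum fun l _ => ?_
    rcases le_or_gt l i with hl | hl
    · exact mul_le_mul_of_nonneg_right (T.singularValues_antitone hl) (sq_nonneg _)
    · simp [hx1 l hl]
  exact le_of_mul_le_mul_right (h2.trans h1) (by positivity)

lemma LinearMap.IsPositive.le_singularValues
    {T : EuclideanSpace ℝ (Fin k) →ₗ[ℝ] EuclideanSpace ℝ (Fin k)}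
    (hT : T.IsPositive) (τ : Equiv.Perm (Fin k)) (i : Fin k) {c : ℝ}
    (h : ∀ x : EuclideanSpace ℝ (Fin k), (∀ j, i < j → x (τ j) = 0) →
      c * ‖x‖ ^ 2 ≤ inner ℝ (T x) x) : c ≤ T.singularValues i := by
  obtain ⟨b, hb⟩ := hT.exists_orthonormalBasis_singularValues (k := k) (by simp)
  obtain ⟨x, hx0, hx1, hx2⟩ := exists_ne_zero_repr_eq_zero
    ((EuclideanSpace.basisFun (Fin k) ℝ).reindex τ.symm) b i
  have h1 := h x (fun j hj => by simpa using hx1 j hj)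
  have h2 : inner ℝ (T x) x ≤ T.singularValues i * ‖x‖ ^ 2 := by
    rw [b.inner_apply_self_eq_sum hb, b.norm_sq_eq_sum, Finset.mul_sum]
    refine Finset.sum_le_sum fun l _ => ?_
    rcases le_or_gt i l with hl | hl
    · exact mul_le_mul_of_nonneg_right (T.singularValues_antitone hl) (sq_nonneg _)
    · simp [hx2 l hl]
  exact le_of_mul_le_mul_right (h1.trans h2) (by positivity)

end MinMax

/-! ### The expected Gram matrix and deterministic singular value bounds -/

namespace SparseGram

section GramMatrix

variable {Ω : Type*} [MeasurableSpace Ω] {P : Measure Ω} {m k : ℕ}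
  {X : Ω → Matrix (Fin m) (Fin k) ℝ} {s : Fin k → ℝ}

lemma CondS2.measurable_entry (h : CondS2 P X s) (r : Fin m) (j : Fin k) :
    Measurable fun ω => X ω r j :=
  (measurable_pi_apply r).comp (h.measurable j)

lemma CondS2.entry_mem_Icc (h : CondS2 P X s) :
    ∀ᵐ ω ∂P, ∀ r j, X ω r j ∈ Set.Icc 0 (s j) := by
  filter_upwards [h.nonneg, h.size_eq] with ω h0 h1 r j
  refine ⟨h0 r j, ?_⟩
  rw [← h1 j]
  exact Finset.single_le_sum (f := fun r => X ω r j) (fun i _ => h0 i j) (Finset.mem_univ r)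

lemma expGram_apply_self (j : Fin k) : expGram P X j j = expNormSq P X j := by
  simp [expGram, expNormSq, normSq, col, Matrix.mul_apply, pow_two]

lemma ae_numNonzero_le : ∀ᵐ ω ∂P, ∀ j, numNonzero (col X j ω) ≤ maxNonzero P X := by
  -- The infimum is attained once the set is non-empty; `m` bounds every support.
  refine Nat.sInf_mem (s := {l : ℕ | ∀ᵐ ω ∂P, ∀ j, numNonzero (col X j ω) ≤ l}) ⟨m, ?_⟩
  refine ae_of_all _ fun ω j => ?_
  simpa [numNonzero] using Set.ncard_le_card {i | col X j ω i ≠ 0}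

/-- Cauchy–Schwarz on the support of `x`. -/
lemma size_sq_le (x : Fin m → ℝ) : size x ^ 2 ≤ numNonzero x * normSq x := by
  classical
  have h1 : size x = ∑ i with x i ≠ 0, x i := (Finset.sum_filter_ne_zero _).symm
  have h2 : numNonzero x = (Finset.univ.filter fun i => x i ≠ 0).card := by
    rw [numNonzero, ← Set.ncard_coe_finset]; simp
  rw [h1, h2]
  refine sq_sum_le_card_mul_sum_sq.trans ?_
  refine mul_le_mul_of_nonneg_left ?_ (Nat.cast_nonneg _)
  exact Finset.sum_le_sum_of_subset_of_nonneg (Finset.filter_subset _ _) fun i _ _ => sq_nonneg _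

variable [IsProbabilityMeasure P]

lemma CondS2.integrable_entry (h : CondS2 P X s) (r : Fin m) (j : Fin k) :
    Integrable (fun ω => X ω r j) P := by
  refine Integrable.of_bound (h.measurable_entry r j).aestronglyMeasurable (s j) ?_
  filter_upwards [h.entry_mem_Icc] with ω hω
  rw [Real.norm_of_nonneg (hω r j).1]
  exact (hω r j).2

lemma CondS2.integrable_entry_mul (h : CondS2 P X s) (r : Fin m) (i j : Fin k) :
    Integrable (fun ω => X ω r i * X ω r j) P := by
  refine Integrable.of_bound
    ((h.measurable_entry r i).mul (h.measurable_entry r j)).aestronglyMeasurable (s i * s j) ?_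
  filter_upwards [h.entry_mem_Icc] with ω hω
  rw [Real.norm_of_nonneg (mul_nonneg (hω r i).1 (hω r j).1)]
  exact mul_le_mul (hω r i).2 (hω r j).2 (hω r j).1 ((hω r i).1.trans (hω r i).2)

lemma CondS2.integrable_normSq (h : CondS2 P X s) (j : Fin k) :
    Integrable (fun ω => normSq (col X j ω)) P := by
  unfold normSq col
  refine integrable_finsetSum _ fun r _ => ?_
  simpa only [pow_two] using h.integrable_entry_mul r j j

/-- Testing invariance on a basis vector and a transposition shows that all entries of a column have
the same mean, and the means add up to the fixed size. -/
lemma CondS2.integral_entry (h : CondS2 P X s) (r : Fin m) (j : Fin k) :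
    ∫ ω, X ω r j ∂P = s j / m := by
  have heq : ∀ r', ∫ ω, X ω r' j ∂P = ∫ ω, X ω r j ∂P := fun r' => by
    have := h.invariant j (Equiv.swap r r') (Pi.single r 1)
    have e : ∀ i, (Pi.single r 1 : Fin m → ℝ) (Equiv.swap r r' i)
        = (Pi.single r' 1 : Fin m → ℝ) i := fun i => by
      simp only [Pi.single_apply, Equiv.swap_apply_def]
      split_ifs <;> simp_all
    simp only [e] at this
    simpa [Pi.single_apply, col] using this
  have hsum : ∑ r', ∫ ω, X ω r' j ∂P = s j := by
    rw [← integral_finsetSum _ fun r' _ => h.integrable_entry r' j]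
    have : (fun ω => ∑ r', X ω r' j) =ᵐ[P] fun _ => s j := by
      filter_upwards [h.size_eq] with ω hω using hω j
    rw [integral_congr_ae this]; simp
  have hm : (m : ℝ) ≠ 0 := by exact_mod_cast r.pos.ne'
  simp only [heq, Finset.sum_const, Finset.card_univ, Fintype.card_fin, nsmul_eq_mul] at hsum
  rw [← hsum]; field_simp

lemma CondS2.expGram_apply_of_ne (h : CondS2 P X s) {i j : Fin k} (hij : i ≠ j) :
    expGram P X i j = s i * s j / m := by
  simp only [expGram, Matrix.of_apply, Matrix.mul_apply, Matrix.transpose_apply]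
  rw [integral_finsetSum _ fun r _ => h.integrable_entry_mul r i j]
  have hmul : ∀ r : Fin m, ∫ ω, X ω r i * X ω r j ∂P = s i / m * (s j / m) := fun r => by
    rw [← h.integral_entry r i, ← h.integral_entry r j]
    have : IndepFun (fun ω => X ω r i) (fun ω => X ω r j) P :=
      (h.indep.indepFun hij).comp (measurable_pi_apply r) (measurable_pi_apply r)
    exact this.integral_fun_mul_eq_mul_integral (h.measurable_entry r i).aestronglyMeasurable
      (h.measurable_entry r j).aestronglyMeasurable
  simp only [hmul, Finset.sum_const, Finset.card_univ, Fintype.card_fin, nsmul_eq_mul]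
  rcases eq_or_ne (m : ℝ) 0 with hm | hm
  · simp [hm]
  · field_simp

/-- The quadratic form of the expected Gram matrix is that of a diagonal matrix plus a rank one
matrix. -/
lemma CondS2.inner_expGram (h : CondS2 P X s) (x : EuclideanSpace ℝ (Fin k)) :
    inner ℝ (Matrix.toEuclideanLin (expGram P X) x) x
      = ∑ j, (expNormSq P X j - s j ^ 2 / m) * x j ^ 2 + (∑ j, s j * x j) ^ 2 / m := by
  have hG : ∀ i j, expGram P X i j
      = (if i = j then expNormSq P X j - s j ^ 2 / m else 0) + s i * s j / m := fun i j => by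
    split_ifs with hij
    · subst hij; rw [expGram_apply_self]; ring
    · rw [h.expGram_apply_of_ne hij]; ring
  have : inner ℝ (Matrix.toEuclideanLin (expGram P X) x) x
      = ∑ i, x i * ∑ j, expGram P X i j * x j := by
    simp [PiLp.inner_apply, Matrix.toLpLin_apply, Matrix.mulVec, dotProduct]
  rw [this]
  simp only [hG, add_mul, Finset.sum_add_distrib, mul_add, ite_mul, zero_mul, Finset.sum_ite_eq,
    Finset.mem_univ, if_true]
  congr 1
  · exact Finset.sum_congr rfl fun j _ => by ring
  · rw [pow_two, Finset.sum_mul_sum, Finset.sum_div]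
    refine Finset.sum_congr rfl fun i _ => ?_
    rw [Finset.mul_sum, Finset.sum_div]
    exact Finset.sum_congr rfl fun j _ => by ring

lemma CondS2.sq_le_mul_expNormSq (h : CondS2 P X s) (j : Fin k) :
    s j ^ 2 ≤ maxNonzero P X * expNormSq P X j := by
  rw [expNormSq, ← integral_const_mul]
  have : s j ^ 2 = ∫ _, s j ^ 2 ∂P := by simp
  rw [this]
  refine integral_mono_ae (integrable_const _) ((h.integrable_normSq j).const_mul _) ?_
  filter_upwards [h.size_eq, ae_numNonzero_le (P := P) (X := X)] with ω h1 h2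
  rw [← h1 j]
  refine (size_sq_le _).trans (mul_le_mul_of_nonneg_right (by exact_mod_cast h2 j) ?_)
  exact Finset.sum_nonneg fun i _ => sq_nonneg _

lemma CondS2.le_expNormSq (h : CondS2 P X s) (h1 : CondS1 P X s) (j : Fin k) :
    s j ≤ expNormSq P X j := by
  have : s j = ∫ _, s j ∂P := by simp
  rw [this, expNormSq]
  refine integral_mono_ae (integrable_const _) (h.integrable_normSq j) ?_
  filter_upwards [h.size_eq, h1.size_le_normSq] with ω h2 h3
  rw [← h2 j]; exact h3 j

lemma CondS2.sq_div_le (hs : CondS2 P X s) (j : Fin k) :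
    s j ^ 2 / m ≤ (maxNonzero P X : ℝ) / m * expNormSq P X j := by
  rw [div_mul_eq_mul_div]
  exact div_le_div_of_nonneg_right (hs.sq_le_mul_expNormSq j) (Nat.cast_nonneg _)

lemma CondS2.isPositive_expGram (hs : CondS2 P X s) (hw0 : ∀ j, 0 ≤ expNormSq P X j)
    (hL : (maxNonzero P X : ℝ) / m ≤ 1) :
    (Matrix.toEuclideanLin (expGram P X)).IsPositive := by
  refine ⟨?_, fun x => ?_⟩
  · rw [Matrix.isSymmetric_toEuclideanLin_iff]
    ext i j
    simp [expGram, Matrix.mul_apply, mul_comm]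
  · simp only [RCLike.re_to_real]
    rw [hs.inner_expGram]
    refine add_nonneg (Finset.sum_nonneg fun j _ => mul_nonneg (sub_nonneg.2 ?_) (sq_nonneg _))
      (by positivity)
    exact (hs.sq_div_le j).trans (mul_le_of_le_one_left (hw0 j) hL)

/-- The lower bound: `G` dominates `(1 - L / m) diag(w)`. -/
lemma CondS2.le_singularValue (hs : CondS2 P X s) (hw0 : ∀ j, 0 ≤ expNormSq P X j)
    (hL : (maxNonzero P X : ℝ) / m ≤ 1)
    (τ : Equiv.Perm (Fin k)) (hτ : Antitone fun i => expNormSq P X (τ i)) (i : Fin k) :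
    (1 - (maxNonzero P X : ℝ) / m) * expNormSq P X (τ i) ≤ singularValue (expGram P X) i := by
  refine (hs.isPositive_expGram hw0 hL).le_singularValues τ i fun x hx => ?_
  rw [hs.inner_expGram, EuclideanSpace.norm_sq_eq, Finset.mul_sum]
  refine le_add_of_le_of_nonneg (Finset.sum_le_sum fun j _ => ?_) (by positivity)
  rw [Real.norm_eq_abs, sq_abs]
  rcases le_or_gt (τ.symm j) i with hj | hj
  · have h1 : expNormSq P X (τ i) ≤ expNormSq P X j := by simpa using hτ hj
    refine mul_le_mul_of_nonneg_right ?_ (sq_nonneg _)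
    have := mul_le_mul_of_nonneg_left h1 (sub_nonneg.2 hL)
    linarith [hs.sq_div_le j]
  · have : x j = 0 := by simpa using hx _ hj
    simp [this]

/-- The upper bound through the restriction of the rank one part to the coordinates
`τ i, τ (i + 1), …`. -/
lemma CondS2.singularValue_le (hs : CondS2 P X s) (hw0 : ∀ j, 0 ≤ expNormSq P X j)
    (hL : (maxNonzero P X : ℝ) / m ≤ 1)
    (τ : Equiv.Perm (Fin k)) (hτ : Antitone fun i => expNormSq P X (τ i)) (i : Fin k) {B : ℝ}
    (hB : ∀ x : Fin k → ℝ, (∀ j, j < i → x (τ j) = 0) →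
      (∑ j, s j * x j) ^ 2 ≤ B * ∑ j, x j ^ 2) :
    singularValue (expGram P X) i ≤ expNormSq P X (τ i) + B / m := by
  refine (hs.isPositive_expGram hw0 hL).singularValues_le τ i fun x hx => ?_
  rw [hs.inner_expGram, add_mul]
  have hn : ‖x‖ ^ 2 = ∑ j, x j ^ 2 := by simp [EuclideanSpace.norm_sq_eq]
  refine add_le_add ?_ ?_
  · rw [hn, Finset.mul_sum]
    refine Finset.sum_le_sum fun j _ => ?_
    rcases lt_or_ge (τ.symm j) i with hj | hj
    · have : x j = 0 := by simpa using hx _ hj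
      simp [this]
    · have h1 : expNormSq P X j ≤ expNormSq P X (τ i) := by simpa using hτ hj
      refine mul_le_mul_of_nonneg_right ?_ (sq_nonneg _)
      have : 0 ≤ s j ^ 2 / m := by positivity
      linarith
  · rw [div_mul_eq_mul_div, hn]
    exact div_le_div_of_nonneg_right (hB x hx) (Nat.cast_nonneg _)

lemma CondS2.singularValue_le_add_sum_sq (hs : CondS2 P X s) (hw0 : ∀ j, 0 ≤ expNormSq P X j)
    (hL : (maxNonzero P X : ℝ) / m ≤ 1)
    (τ : Equiv.Perm (Fin k)) (hτ : Antitone fun i => expNormSq P X (τ i)) (i : Fin k) :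
    singularValue (expGram P X) i ≤ expNormSq P X (τ i) + (∑ j, s j ^ 2) / m :=
  hs.singularValue_le hw0 hL τ hτ i fun _ _ => Finset.sum_mul_sq_le_sq_mul_sq _ _ _

/-- Cauchy–Schwarz with weights `s_j`: on the tail `(∑ s_j x_j)² ≤ (∑ s_j)(∑ s_j x_j²)`, and there
`s_j ≤ w_j ≤ w_{τ i}`. Only the tail sum of sizes enters, which pays off when the tail is short. -/
lemma CondS2.singularValue_le_mul_sum (hs : CondS2 P X s) (hs0 : ∀ j, 0 ≤ s j)
    (hsw : ∀ j, s j ≤ expNormSq P X j) (hL : (maxNonzero P X : ℝ) / m ≤ 1)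
    (τ : Equiv.Perm (Fin k)) (hτ : Antitone fun i => expNormSq P X (τ i)) (i : Fin k) :
    singularValue (expGram P X) i
      ≤ (1 + (∑ j with i ≤ τ.symm j, s j) / m) * expNormSq P X (τ i) := by
  have := hs.singularValue_le (fun j => (hs0 j).trans (hsw j)) hL τ hτ i
    (B := (∑ j with i ≤ τ.symm j, s j) * expNormSq P X (τ i)) fun x hx => by
      have h0 : ∀ j, ¬ i ≤ τ.symm j → x j = 0 := fun j hj => by
        simpa using hx _ (not_le.1 hj)
      have h1 : ∑ j, s j * x j = ∑ j with i ≤ τ.symm j, √(s j) * (√(s j) * x j) := by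
        rw [Finset.sum_filter]
        refine Finset.sum_congr rfl fun j _ => ?_
        split_ifs with hj
        · rw [← mul_assoc, Real.mul_self_sqrt (hs0 j)]
        · simp [h0 j hj]
      rw [h1, mul_assoc]
      refine (Finset.sum_mul_sq_le_sq_mul_sq _ _ _).trans ?_
      simp only [mul_pow, Real.sq_sqrt (hs0 _)]
      refine mul_le_mul_of_nonneg_left ?_ (Finset.sum_nonneg fun j _ => hs0 j)
      rw [Finset.sum_filter, Finset.mul_sum]
      refine Finset.sum_le_sum fun j _ => ?_
      split_ifs with hj
      · have h2 : expNormSq P X j ≤ expNormSq P X (τ i) := by simpa using hτ hj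
        exact mul_le_mul_of_nonneg_right ((hsw j).trans h2) (sq_nonneg _)
      · simp [h0 j hj]
  linarith [add_mul 1 ((∑ j with i ≤ τ.symm j, s j) / (m : ℝ)) (expNormSq P X (τ i)),
    div_mul_eq_mul_div (∑ j with i ≤ τ.symm j, s j) (m : ℝ) (expNormSq P X (τ i))]

/-- The dichotomy on whether a size with `s_j² ≥ R²(1 + δ)` occurs at a position from `i` on. If so,
`w_{τ i} ≥ s_j ≥ R(1 + δ')` and the full sum of squares is affordable; if not, the tail misses at
least `k/1000` indices. -/
lemma CondS2.singularValue_le_of_sum_sq_le (hs : CondS2 P X s) (hs0 : ∀ j, 0 ≤ s j)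
    (hsw : ∀ j, s j ≤ expNormSq P X j) (hL : (maxNonzero P X : ℝ) / m ≤ 1)
    (τ : Equiv.Perm (Fin k)) (hτ : Antitone fun i => expNormSq P X (τ i)) (i : Fin k)
    {R δ δ' : ℝ} (hR : 0 ≤ R) (hδ'1 : δ' ≤ 1 / 1000)
    (hδ : (1 + δ') ^ 2 ≤ 1 + δ) (hsum : ∑ j, s j ^ 2 ≤ k * (R ^ 2 * (1 + δ')))
    (hcard : (k : ℝ) / 1000
      ≤ ((Finset.univ.filter fun j => R ^ 2 * (1 + δ) ≤ s j ^ 2).card : ℝ)) :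
    singularValue (expGram P X) i ≤ (1 + k * R / m) * expNormSq P X (τ i) := by
  have hm : (0 : ℝ) ≤ m := Nat.cast_nonneg _
  have hw := (hs0 (τ i)).trans (hsw (τ i))
  by_cases hi : ∃ j, R ^ 2 * (1 + δ) ≤ s j ^ 2 ∧ i ≤ τ.symm j
  · obtain ⟨j, hj, hij⟩ := hi
    refine (hs.singularValue_le_add_sum_sq (fun j => (hs0 j).trans (hsw j)) hL τ hτ i).trans ?_
    have h1 : R * (1 + δ') ≤ s j := by
      refine abs_le_of_sq_le_sq' ?_ (hs0 j) |>.2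
      rw [mul_pow]
      exact (mul_le_mul_of_nonneg_left hδ (sq_nonneg R)).trans hj
    have h2 : s j ≤ expNormSq P X (τ i) := (hsw j).trans (by simpa using hτ hij)
    have h3 : ∑ j, s j ^ 2 ≤ k * R * expNormSq P X (τ i) := by
      refine hsum.trans ?_
      have := mul_le_mul_of_nonneg_left (h1.trans h2) (mul_nonneg (Nat.cast_nonneg k) hR)
      linarith
    have h4 := div_le_div_of_nonneg_right h3 hm
    rw [add_mul, one_mul, div_mul_eq_mul_div]
    linarith
  · push Not at hi
    refine (hs.singularValue_le_mul_sum hs0 hsw hL τ hτ i).trans ?_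
    refine mul_le_mul_of_nonneg_right ?_ hw
    refine add_le_add le_rfl (div_le_div_of_nonneg_right ?_ hm)
    have hle : (Finset.univ.filter fun j => R ^ 2 * (1 + δ) ≤ s j ^ 2).card ≤ (i : ℕ) := by
      rw [← Fin.card_Iio, ← Finset.card_map τ.symm.toEmbedding]
      refine Finset.card_le_card fun j hj => ?_
      rw [Finset.mem_map_equiv] at hj
      simpa using hi (τ j) (by simpa using hj)
    have hT : (Finset.univ.filter fun j => i ≤ τ.symm j).card = k - i := by
      rw [← Fin.card_Ici, ← Finset.card_map τ.symm.toEmbedding]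
      congr 1; ext j; simp [Finset.mem_map_equiv]
    have hT' : ((Finset.univ.filter fun j => i ≤ τ.symm j).card : ℝ) ≤ k * (999 / 1000) := by
      rw [hT, Nat.cast_sub i.2.le]
      have : ((Finset.univ.filter fun j => R ^ 2 * (1 + δ) ≤ s j ^ 2).card : ℝ) ≤ (i : ℕ) := by
        exact_mod_cast hle
      linarith
    -- The missing indices outweigh the excess of the second moment: `(999/1000)(1001/1000) < 1`.
    refine abs_le_of_sq_le_sq' ?_ (by positivity) |>.2
    have hT2 : ∑ j with i ≤ τ.symm j, s j ^ 2 ≤ k * (R ^ 2 * (1 + 1 / 1000)) := by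
      refine (Finset.sum_le_sum_of_subset_of_nonneg (Finset.filter_subset _ _)
        fun j _ _ => sq_nonneg _).trans (hsum.trans ?_)
      gcongr
    refine sq_sum_le_card_mul_sum_sq.trans ((mul_le_mul hT' hT2
      (Finset.sum_nonneg fun j _ => sq_nonneg _) (by positivity)).trans ?_)
    have : 0 ≤ (k * R) ^ 2 := sq_nonneg _
    linarith

end GramMatrix

end SparseGram

/-! ### Moments and lower tail of the gamma distribution -/

section GammaMoments

open Real

variable {α β : ℝ}

lemma integral_gammaMeasure (f : ℝ → ℝ) (hα : 0 < α) (hβ : 0 < β) :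
    ∫ x, f x ∂gammaMeasure α β = ∫ x, gammaPDFReal α β x * f x := by
  unfold gammaMeasure gammaPDF
  rw [integral_withDensity_eq_integral_toReal_smul (by fun_prop) (by simp)]
  simp [ENNReal.toReal_ofReal (gammaPDFReal_nonneg hα hβ _)]

lemma gammaPDFReal_mul_pow (hα : 0 < α) (hβ : 0 < β) (n : ℕ) {x : ℝ} (hx : 0 < x) :
    gammaPDFReal α β x * x ^ n
      = (Gamma (α + n) / Gamma α / β ^ n) * gammaPDFReal (α + n) β x := by
  have h1 := (Gamma_pos_of_pos hα).ne'
  have h2 := (Gamma_pos_of_pos (show 0 < α + n by positivity)).ne'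
  rw [gammaPDFReal, gammaPDFReal, if_pos hx.le, if_pos hx.le, rpow_add hβ, rpow_natCast,
    show α + n - 1 = (α - 1) + n by ring, rpow_add hx, rpow_natCast]
  field_simp

lemma gammaPDFReal_mul_pow_ae (hα : 0 < α) (hβ : 0 < β) (n : ℕ) :
    (fun x => gammaPDFReal α β x * x ^ n) =ᵐ[volume] fun x =>
      (Gamma (α + n) / Gamma α / β ^ n) * gammaPDFReal (α + n) β x := by
  filter_upwards [Measure.ae_ne volume (0 : ℝ)] with x hx
  rcases lt_or_gt_of_ne hx with h | h
  · simp [gammaPDFReal, not_le.2 h]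
  · exact gammaPDFReal_mul_pow hα hβ n h

lemma integrable_gammaPDFReal (hα : 0 < α) (hβ : 0 < β) : Integrable (gammaPDFReal α β) := by
  refine ⟨(measurable_gammaPDFReal α β).aestronglyMeasurable, ?_⟩
  rw [hasFiniteIntegral_iff_ofReal (ae_of_all _ (gammaPDFReal_nonneg hα hβ))]
  have := lintegral_gammaPDF_eq_one hα hβ
  unfold gammaPDF at this
  simp [this]

lemma integral_gammaPDFReal (hα : 0 < α) (hβ : 0 < β) : ∫ x, gammaPDFReal α β x = 1 := by
  rw [integral_eq_lintegral_of_nonneg_ae (ae_of_all _ (gammaPDFReal_nonneg hα hβ))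
    (measurable_gammaPDFReal α β).aestronglyMeasurable]
  have := lintegral_gammaPDF_eq_one hα hβ
  unfold gammaPDF at this
  simp [this]

lemma integrable_pow_gammaMeasure (hα : 0 < α) (hβ : 0 < β) (n : ℕ) :
    Integrable (fun x => x ^ n) (gammaMeasure α β) := by
  unfold gammaMeasure gammaPDF
  rw [integrable_withDensity_iff_integrable_smul' (by fun_prop) (by simp)]
  simp only [ENNReal.toReal_ofReal (gammaPDFReal_nonneg hα hβ _), smul_eq_mul]
  exact ((integrable_gammaPDFReal (by positivity) hβ).const_mul _).congr
    (gammaPDFReal_mul_pow_ae hα hβ n).symm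

lemma integral_pow_gammaMeasure (hα : 0 < α) (hβ : 0 < β) (n : ℕ) :
    ∫ x, x ^ n ∂gammaMeasure α β = (∏ i ∈ Finset.range n, (α + i)) / β ^ n := by
  rw [integral_gammaMeasure _ hα hβ, integral_congr_ae (gammaPDFReal_mul_pow_ae hα hβ n),
    integral_const_mul, integral_gammaPDFReal (by positivity) hβ, mul_one]
  congr 1
  induction n with
  | zero => simp [(Gamma_pos_of_pos hα).ne']
  | succ n ih =>
    rw [Finset.prod_range_succ, ← ih, Nat.cast_succ, ← add_assoc,
      Gamma_add_one (by positivity)]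
    ring

/-- On `[1, ∞)` the integrand `e^{-x} x^{α-1}` is at least `e^{-x}`. -/
lemma exp_neg_one_le_Gamma (hα : 1 ≤ α) : exp (-1) ≤ Gamma α := by
  rw [Gamma_eq_integral (by linarith), ← integral_exp_neg_Ioi 1]
  have hint := GammaIntegral_convergent (show 0 < α by linarith)
  refine le_trans ?_ (setIntegral_mono_set hint ?_
    (Set.Ioi_subset_Ioi zero_le_one).eventuallyLE)
  · refine setIntegral_mono_on (integrableOn_exp_neg_Ioi 1)
      (hint.mono_set (Set.Ioi_subset_Ioi zero_le_one)) measurableSet_Ioi fun x hx => ?_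
    have : 1 ≤ x ^ (α - 1) := one_le_rpow (Set.mem_Ioi.1 hx).le (by linarith)
    exact le_mul_of_one_le_right (exp_pos _).le this
  · filter_upwards [self_mem_ae_restrict measurableSet_Ioi] with x hx
    have : 0 < x := hx
    simp only [Pi.zero_apply]
    positivity

/-- Dropping `e^{-βx}` from the density leaves `β^α / (α Γ(α))`. The factor `1/α` is kept because
the relative standard deviation of `x²` may be small for large `α`. -/
lemma gammaMeasure_real_Iio_one_le (hα : 1 ≤ α) (hβ : 0 < β) (hβ1 : β ≤ 1) :
    (gammaMeasure α β).real (Set.Iio 1) ≤ exp 1 * β / α := by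
  have hα0 : 0 < α := by linarith
  have := isProbabilityMeasure_gammaMeasure hα0 hβ
  have hG := Gamma_pos_of_pos hα0
  have h1 : (gammaMeasure α β).real (Set.Iio 1)
      = ∫ x in Set.Iio 1, gammaPDFReal α β x := by
    rw [measureReal_def, gammaMeasure, withDensity_apply _ measurableSet_Iio]
    exact (integral_eq_lintegral_of_nonneg_ae (ae_of_all _ (gammaPDFReal_nonneg hα0 hβ))
      (by fun_prop)).symm
  have h2 : ∫ x in Set.Iio 1, gammaPDFReal α β x
      ≤ ∫ x in Set.Ioc (0 : ℝ) 1, β ^ α / Gamma α * x ^ (α - 1) := by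
    rw [← integral_indicator measurableSet_Iio, ← integral_indicator measurableSet_Ioc]
    refine integral_mono_ae ((integrable_gammaPDFReal hα0 hβ).indicator measurableSet_Iio) ?_ ?_
    · rw [integrable_indicator_iff measurableSet_Ioc]
      exact ((intervalIntegral.intervalIntegrable_rpow' (by linarith)).1).const_mul _
    · filter_upwards [Measure.ae_ne volume (0 : ℝ)] with x hx
      by_cases hx1 : x < 1
      · rcases lt_or_gt_of_ne hx with h | h
        · simp [Set.indicator, gammaPDFReal, not_le.2 h, not_lt.2 h.le]
        · simp only [Set.indicator, Set.mem_Iio, hx1, if_true, Set.mem_Ioc, h, hx1.le,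
            gammaPDFReal, h.le, and_self]
          refine mul_le_of_le_one_right (by positivity) ?_
          rw [exp_le_one_iff]
          have : 0 < β * x := by positivity
          linarith
      · rw [Set.indicator_of_notMem (by simpa using hx1)]
        refine Set.indicator_nonneg (fun y hy => ?_) _
        have : 0 < y := hy.1
        positivity
  have h3 : ∫ x in Set.Ioc (0 : ℝ) 1, β ^ α / Gamma α * x ^ (α - 1) = β ^ α / Gamma α / α := by
    rw [integral_const_mul, ← intervalIntegral.integral_of_le zero_le_one,
      integral_rpow (Or.inl (by linarith))]
    simp [hα0.ne', div_eq_mul_inv]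
  have h4 : β ^ α ≤ β := by
    simpa using rpow_le_rpow_of_exponent_ge hβ hβ1 hα
  rw [h1]
  refine h2.trans (h3.trans_le (div_le_div_of_nonneg_right ?_ hα0.le))
  rw [div_le_iff₀ hG]
  have h5 := exp_neg_one_le_Gamma hα
  have h6 : exp 1 * exp (-1) = 1 := by rw [← exp_add]; simp
  calc β ^ α ≤ β * (exp 1 * exp (-1)) := by rw [h6]; linarith
    _ ≤ β * (exp 1 * Gamma α) := by gcongr
    _ = _ := by ring

/-- The variance of the square of a gamma variable, relative to the square of its mean. -/
noncomputable def gammaSqRelVar (α : ℝ) : ℝ := (4 * α + 6) / (α * (α + 1))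

lemma gammaSqRelVar_pos (hα : 0 < α) : 0 < gammaSqRelVar α := by
  unfold gammaSqRelVar; positivity

lemma gammaSqRelVar_le (hα : 1 ≤ α) : gammaSqRelVar α ≤ 5 := by
  unfold gammaSqRelVar
  rw [div_le_iff₀ (by positivity)]
  nlinarith

lemma sq_div_sub_one_pow (c x : ℝ) (n : ℕ) :
    (x ^ 2 / c - 1) ^ n = ∑ i ∈ Finset.range (n + 1),
      ((1 / c) ^ i * (-1) ^ (n - i) * n.choose i) * x ^ (2 * i) := by
  rw [sub_eq_add_neg, add_pow]
  refine Finset.sum_congr rfl fun i _ => ?_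
  rw [div_eq_mul_one_div, mul_pow, ← pow_mul]; ring

lemma integrable_sq_div_sub_one_pow (hα : 0 < α) (hβ : 0 < β) (c : ℝ) (n : ℕ) :
    Integrable (fun x => (x ^ 2 / c - 1) ^ n) (gammaMeasure α β) := by
  simp only [sq_div_sub_one_pow]
  exact integrable_finsetSum _ fun i _ => (integrable_pow_gammaMeasure hα hβ (2 * i)).const_mul _

lemma integral_sq_div_sub_one_pow (hα : 0 < α) (hβ : 0 < β) (c : ℝ) (n : ℕ) :
    ∫ x, (x ^ 2 / c - 1) ^ n ∂gammaMeasure α β = ∑ i ∈ Finset.range (n + 1),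
      ((1 / c) ^ i * (-1) ^ (n - i) * n.choose i)
        * ((∏ j ∈ Finset.range (2 * i), (α + j)) / β ^ (2 * i)) := by
  simp only [sq_div_sub_one_pow]
  rw [integral_finsetSum _ fun i _ => (integrable_pow_gammaMeasure hα hβ (2 * i)).const_mul _]
  simp only [integral_const_mul, integral_pow_gammaMeasure hα hβ]

lemma integral_sq_div_sub_one (hα : 0 < α) (hβ : 0 < β) :
    ∫ x, (x ^ 2 / (α * (α + 1) / β ^ 2) - 1) ∂gammaMeasure α β = 0 := by
  have h := integral_sq_div_sub_one_pow hα hβ (α * (α + 1) / β ^ 2) 1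
  simp only [pow_one] at h
  rw [h]
  simp [Finset.sum_range_succ, Finset.prod_range_succ]
  field_simp
  simp

lemma integral_sq_div_sub_one_sq (hα : 0 < α) (hβ : 0 < β) :
    ∫ x, (x ^ 2 / (α * (α + 1) / β ^ 2) - 1) ^ 2 ∂gammaMeasure α β = gammaSqRelVar α := by
  rw [integral_sq_div_sub_one_pow hα hβ]
  simp [Finset.sum_range_succ, Finset.prod_range_succ, gammaSqRelVar, Nat.choose]
  field_simp
  ring

lemma integral_sq_div_sub_one_pow_four_le (hα : 1 ≤ α) (hβ : 0 < β) :
    ∫ x, (x ^ 2 / (α * (α + 1) / β ^ 2) - 1) ^ 4 ∂gammaMeasure α β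
      ≤ 100 * gammaSqRelVar α ^ 2 := by
  have hα0 : 0 < α := by linarith
  have h : ∫ x, (x ^ 2 / (α * (α + 1) / β ^ 2) - 1) ^ 4 ∂gammaMeasure α β
      = ((α + 2) * (α + 3) * (α + 4) * (α + 5) * (α + 6) * (α + 7)
        - 4 * (α * (α + 1)) * ((α + 2) * (α + 3) * (α + 4) * (α + 5))
        + 6 * (α * (α + 1)) ^ 2 * ((α + 2) * (α + 3)) - 3 * (α * (α + 1)) ^ 3)
        / (α * (α + 1)) ^ 3 := by
    rw [integral_sq_div_sub_one_pow hα0 hβ]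
    simp [Finset.sum_range_succ, Finset.prod_range_succ, Nat.choose]
    field_simp
    ring
  rw [h, gammaSqRelVar, div_pow, mul_div_assoc', div_le_div_iff₀ (by positivity) (by positivity),
    ← sub_nonneg]
  -- In the variable `t = α - 1 ≥ 0` the difference has only non-negative coefficients.
  obtain ⟨t, rfl⟩ : ∃ t, α = 1 + t := ⟨α - 1, by ring⟩
  have ht : 0 ≤ t := by linarith
  ring_nf
  positivity

end GammaMoments

/-! ### Chebyshev and anti-concentration from bounded kurtosis -/

section Concentration

/-- Chebyshev's inequality for the upper tail of the sum over an independent sample. -/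
lemma measureReal_pi_sum_lt_le {k : ℕ} (hk : 0 < k) {μ : Measure ℝ} [IsProbabilityMeasure μ]
    {f : ℝ → ℝ} (hf : MemLp f 2 μ) {a V x : ℝ} (ha : ∫ t, f t ∂μ ≤ a)
    (hV : ∫ t, f t ^ 2 ∂μ ≤ V) (hx : 0 < x) :
    (Measure.pi fun _ : Fin k => μ).real {s | k * (a + x) < ∑ j, f (s j)} ≤ V / (k * x ^ 2) := by
  have hk' : (0 : ℝ) < k := Nat.cast_pos.2 hk
  have hmp := fun j : Fin k => measurePreserving_eval (fun _ : Fin k => μ) j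
  have hmem : ∀ j : Fin k, MemLp (fun s : Fin k → ℝ => f (s j)) 2 (Measure.pi fun _ => μ) :=
    fun j => hf.comp_measurePreserving (hmp j)
  have hint : ∀ j : Fin k, ∫ s : Fin k → ℝ, f (s j) ∂(Measure.pi fun _ => μ) = ∫ t, f t ∂μ :=
    fun j => by
      have hm := (hmp j).map_eq
      conv_rhs => rw [← hm]
      rw [integral_map (hmp j).measurable.aemeasurable (by rw [hm]; exact hf.1)]
  set Y : (Fin k → ℝ) → ℝ := ∑ j, fun s => f (s j) with hY
  have hYmem : MemLp Y 2 (Measure.pi fun _ : Fin k => μ) := memLp_finsetSum' _ fun j _ => hmem j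
  have hYs : ∀ s, Y s = ∑ j, f (s j) := fun s => by simp [hY]
  have hmean : ∫ s, Y s ∂(Measure.pi fun _ : Fin k => μ) = k * ∫ t, f t ∂μ := by
    simp only [hYs]
    rw [integral_finsetSum _ fun j _ => (hmem j).integrable one_le_two]
    simp [hint]
  have hvar : variance Y (Measure.pi fun _ : Fin k => μ) ≤ k * V := by
    rw [hY, variance_sum_pi fun _ => hf]
    simp only [Finset.sum_const, Finset.card_univ, Fintype.card_fin, nsmul_eq_mul]
    refine mul_le_mul_of_nonneg_left ?_ hk'.le
    refine (variance_le_expectation_sq hf.1).trans ?_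
    simpa using hV
  have h := meas_ge_le_variance_div_sq hYmem (mul_pos hk' hx)
  have hsub : {s : Fin k → ℝ | k * (a + x) < ∑ j, f (s j)}
      ⊆ {s : Fin k → ℝ | k * x ≤ |Y s - ∫ s, Y s ∂(Measure.pi fun _ : Fin k => μ)|} := fun s hs => by
    have hs' : k * (a + x) < ∑ j, f (s j) := hs
    have := mul_le_mul_of_nonneg_left ha hk'.le
    change k * x ≤ |Y s - ∫ s, Y s ∂(Measure.pi fun _ : Fin k => μ)|
    refine le_trans ?_ (le_abs_self _)
    rw [hmean, hYs]
    linarith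
  have h2 := ENNReal.toReal_mono ENNReal.ofReal_ne_top ((measure_mono hsub).trans h)
  rw [ENNReal.toReal_ofReal (div_nonneg (variance_nonneg _ _) (sq_nonneg _))] at h2
  refine h2.trans ((div_le_div_of_nonneg_right hvar (sq_nonneg _)).trans_eq ?_)
  field_simp

/-- A polynomial below a multiple of the indicator turns moments into a lower bound for the tail.
With mean `0`, variance `1` and fourth moment at most `100` its expectation is at least `9/50 -
9/100 - 9/200 = 9/200`. -/
lemma quartic_minorant_le_indicator (z : ℝ) :
    z + 9 / 50 * z ^ 2 - 9 / 10000 * z ^ 4 - 9 / 200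
      ≤ Set.indicator (Set.Ici (1 / 25)) (fun _ => (20 : ℝ)) z := by
  by_cases hz : 1 / 25 ≤ z
  · rw [Set.indicator_of_mem (Set.mem_Ici.2 hz)]
    nlinarith [sq_nonneg (z - 11), sq_nonneg (z ^ 2 - 125)]
  · rw [Set.indicator_of_notMem (by simpa using hz)]
    push Not at hz
    have h4 : 0 ≤ z ^ 4 := by positivity
    rcases le_or_gt 0 z with h | h
    · nlinarith
    -- For `z < 0` the polynomial without its constant term is close to `9/10000 * z * (z + 41/5)² *
    -- (82/5 - z) ≤ 0`.
    · have h1 : 0 ≤ (z + 41 / 5) ^ 2 * (82 / 5 - z) := by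
        have : 0 ≤ 82 / 5 - z := by linarith
        positivity
      have h2 := mul_nonneg (neg_nonneg.2 h.le) h1
      nlinarith [sq_nonneg z]

/-- A centred random variable with bounded kurtosis exceeds a fixed fraction of its standard
deviation with probability bounded below. -/
lemma le_measureReal_of_kurtosis_le {Ω : Type*} [MeasurableSpace Ω] {μ : Measure Ω}
    [IsProbabilityMeasure μ] {Z : Ω → ℝ} (hZ : Measurable Z) (h1 : Integrable Z μ)
    (h2 : Integrable (fun ω => Z ω ^ 2) μ) (h4 : Integrable (fun ω => Z ω ^ 4) μ) {σ : ℝ}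
    (hσ : 0 < σ) (hmean : ∫ ω, Z ω ∂μ = 0) (hvar : ∫ ω, Z ω ^ 2 ∂μ = σ ^ 2)
    (hkur : ∫ ω, Z ω ^ 4 ∂μ ≤ 100 * σ ^ 4) :
    9 / 4000 ≤ μ.real {ω | 1 / 25 * σ ≤ Z ω} := by
  have hset : MeasurableSet {ω | 1 / 25 * σ ≤ Z ω} := measurableSet_le measurable_const hZ
  have hpt : ∀ ω, 1 / σ * Z ω + 9 / 50 / σ ^ 2 * Z ω ^ 2 - 9 / 10000 / σ ^ 4 * Z ω ^ 4 - 9 / 200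
      ≤ Set.indicator {ω | 1 / 25 * σ ≤ Z ω} (fun _ => (20 : ℝ)) ω := fun ω => by
    convert quartic_minorant_le_indicator (Z ω / σ) using 1
    · ring
    · simp only [Set.indicator, Set.mem_ofPred_eq, Set.mem_Ici, le_div_iff₀ hσ]
  have i1 : Integrable (fun ω => 1 / σ * Z ω) μ := h1.const_mul _
  have i2 : Integrable (fun ω => 9 / 50 / σ ^ 2 * Z ω ^ 2) μ := h2.const_mul _
  have i4 : Integrable (fun ω => 9 / 10000 / σ ^ 4 * Z ω ^ 4) μ := h4.const_mul _
  have i12 : Integrable (fun ω => 1 / σ * Z ω + 9 / 50 / σ ^ 2 * Z ω ^ 2) μ := i1.add i2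
  have i124 : Integrable (fun ω => 1 / σ * Z ω + 9 / 50 / σ ^ 2 * Z ω ^ 2
    - 9 / 10000 / σ ^ 4 * Z ω ^ 4) μ := i12.sub i4
  have i0 : Integrable (fun ω => 1 / σ * Z ω + 9 / 50 / σ ^ 2 * Z ω ^ 2
    - 9 / 10000 / σ ^ 4 * Z ω ^ 4 - 9 / 200) μ := i124.sub (integrable_const _)
  have hi := integral_mono i0
    ((integrable_const (20 : ℝ)).indicator hset) hpt
  rw [integral_sub i124 (integrable_const _), integral_sub i12 i4, integral_add i1 i2,
    integral_const_mul, integral_const_mul, integral_const_mul, hmean, hvar,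
    integral_indicator_const _ hset] at hi
  have e1 : 9 / 50 / σ ^ 2 * σ ^ 2 = 9 / 50 := by field_simp
  have e2 : 9 / 10000 / σ ^ 4 * ∫ ω, Z ω ^ 4 ∂μ ≤ 9 / 100 := by
    refine (mul_le_mul_of_nonneg_left hkur (by positivity)).trans_eq ?_
    field_simp; norm_num
  rw [e1] at hi
  simp only [integral_const, probReal_univ, smul_eq_mul] at hi
  linarith

end Concentration

/-! ### Typical samples from the truncated gamma distribution -/

namespace SparseGram

section Sample

variable {α β : ℝ}

lemma integral_truncGamma (α β : ℝ) (f : ℝ → ℝ) :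
    ∫ x, f x ∂truncGamma 1 α β
      = ((gammaMeasure α β).real (Set.Ici 1))⁻¹ * ∫ x in Set.Ici 1, f x ∂gammaMeasure α β := by
  rw [truncGamma, ProbabilityTheory.cond, integral_smul_measure, ENNReal.toReal_inv]; rfl

lemma gammaMeasure_real_Iio_one_le_of_le (hα : 1 ≤ α) (hβ : 0 < β) (hβ' : β ≤ 1 / 30000) :
    (gammaMeasure α β).real (Set.Iio 1) ≤ 1 / (10000 * α) := by
  refine (gammaMeasure_real_Iio_one_le hα hβ (by linarith)).trans ?_
  have h : Real.exp 1 * β ≤ 1 / 10000 := by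
    have := Real.exp_one_lt_d9
    nlinarith [Real.exp_pos 1]
  refine (div_le_div_of_nonneg_right h (by linarith)).trans_eq ?_
  field_simp

lemma half_le_gammaMeasure_real_Ici (hα : 1 ≤ α) (hβ : 0 < β) (hβ' : β ≤ 1 / 30000) :
    1 / 2 ≤ (gammaMeasure α β).real (Set.Ici 1) := by
  have := isProbabilityMeasure_gammaMeasure (zero_lt_one.trans_le hα) hβ
  have h := gammaMeasure_real_Iio_one_le_of_le hα hβ hβ'
  have h1 : 1 / (10000 * α) ≤ 1 / 10000 := by
    apply one_div_le_one_div_of_le <;> linarith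
  rw [← Set.compl_Iio, measureReal_compl measurableSet_Iio, probReal_univ]
  linarith

lemma isProbabilityMeasure_truncGamma (hα : 1 ≤ α) (hβ : 0 < β) (hβ' : β ≤ 1 / 30000) :
    IsProbabilityMeasure (truncGamma 1 α β) := by
  have := isProbabilityMeasure_gammaMeasure (zero_lt_one.trans_le hα) hβ
  refine cond_isProbabilityMeasure fun h => ?_
  have := half_le_gammaMeasure_real_Ici hα hβ hβ'
  rw [measureReal_def, h] at this
  norm_num at this

lemma integrable_truncGamma {f : ℝ → ℝ} (hf : Integrable f (gammaMeasure α β))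
    (hα : 1 ≤ α) (hβ : 0 < β) (hβ' : β ≤ 1 / 30000) : Integrable f (truncGamma 1 α β) := by
  refine hf.restrict.smul_measure (ENNReal.inv_ne_top.2 fun h => ?_)
  have := half_le_gammaMeasure_real_Ici hα hβ hβ'
  rw [measureReal_def, h] at this
  norm_num at this

lemma memLp_two_truncGamma (hα : 1 ≤ α) (hβ : 0 < β) (hβ' : β ≤ 1 / 30000) (c : ℝ) :
    MemLp (fun x => x ^ 2 / c - 1) 2 (truncGamma 1 α β) := by
  rw [memLp_two_iff_integrable_sq (by fun_prop)]
  exact integrable_truncGamma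
    (integrable_sq_div_sub_one_pow (zero_lt_one.trans_le hα) hβ c 2) hα hβ hβ'

lemma integral_sq_truncGamma_le (hα : 1 ≤ α) (hβ : 0 < β) (hβ' : β ≤ 1 / 30000) :
    ∫ x, (x ^ 2 / (α * (α + 1) / β ^ 2) - 1) ^ 2 ∂truncGamma 1 α β ≤ 2 * gammaSqRelVar α := by
  have hα0 := zero_lt_one.trans_le hα
  have h := half_le_gammaMeasure_real_Ici hα hβ hβ'
  rw [integral_truncGamma, ← integral_sq_div_sub_one_sq hα0 hβ]
  refine mul_le_mul (inv_le_of_inv_le₀ (by norm_num) (by linarith)) ?_ ?_ (by norm_num)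
  · exact setIntegral_le_integral (integrable_sq_div_sub_one_pow hα0 hβ _ 2)
      (ae_of_all _ fun x => sq_nonneg _)
  · exact integral_nonneg fun x => sq_nonneg _

/-- The integrand has mean zero before truncation and is at least `-1` on the removed part, so
truncation raises its integral by at most the removed mass; normalisation costs a factor of at most
`2`. -/
lemma integral_truncGamma_le (hα : 1 ≤ α) (hβ : 0 < β) (hβ' : β ≤ 1 / 30000) :
    ∫ x, (x ^ 2 / (α * (α + 1) / β ^ 2) - 1) ∂truncGamma 1 α β ≤ 1 / (5000 * α) := by
  have hα0 := zero_lt_one.trans_le hα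
  have := isProbabilityMeasure_gammaMeasure hα0 hβ
  have h := half_le_gammaMeasure_real_Ici hα hβ hβ'
  have hint := integrable_sq_div_sub_one_pow hα0 hβ (α * (α + 1) / β ^ 2) 1
  simp only [pow_one] at hint
  have hsplit := integral_add_compl (measurableSet_Ici (a := (1 : ℝ))) hint
  rw [integral_sq_div_sub_one hα0 hβ, Set.compl_Ici] at hsplit
  have hlow : -(gammaMeasure α β).real (Set.Iio 1)
      ≤ ∫ x in Set.Iio 1, (x ^ 2 / (α * (α + 1) / β ^ 2) - 1) ∂gammaMeasure α β := by
    have : -(gammaMeasure α β).real (Set.Iio 1)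
        = ∫ x in Set.Iio 1, (-1 : ℝ) ∂gammaMeasure α β := by simp
    rw [this]
    refine integral_mono (integrable_const _) hint.restrict fun x => ?_
    have : 0 ≤ x ^ 2 / (α * (α + 1) / β ^ 2) := by positivity
    linarith
  have hp := gammaMeasure_real_Iio_one_le_of_le hα hβ hβ'
  rw [integral_truncGamma]
  calc _ ≤ ((gammaMeasure α β).real (Set.Ici 1))⁻¹ * (1 / (10000 * α)) := by
        refine mul_le_mul_of_nonneg_left (by linarith) (inv_nonneg.2 measureReal_nonneg)
    _ ≤ 2 * (1 / (10000 * α)) := by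
        refine mul_le_mul_of_nonneg_right (inv_le_of_inv_le₀ (by norm_num) (by linarith))
          (by positivity)
    _ = _ := by field_simp; norm_num

/-- The sizes whose square exceeds the mean square of the gamma distribution by a fixed fraction of
the standard deviation. -/
def largeSizes (α β : ℝ) : Set ℝ :=
  {x | 1 / 25 * √(gammaSqRelVar α) ≤ x ^ 2 / (α * (α + 1) / β ^ 2) - 1}

lemma measurableSet_largeSizes (α β : ℝ) : MeasurableSet (largeSizes α β) :=
  measurableSet_le measurable_const (by fun_prop)

/-- The kurtosis bound gives mass `9/4000` before truncation, of which at most `1/10000` is lost. -/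
lemma le_truncGamma_real_largeSizes (hα : 1 ≤ α) (hβ : 0 < β) (hβ' : β ≤ 1 / 30000) :
    1 / 500 ≤ (truncGamma 1 α β).real (largeSizes α β) := by
  have hα0 := zero_lt_one.trans_le hα
  have := isProbabilityMeasure_gammaMeasure hα0 hβ
  have hv := gammaSqRelVar_pos hα0
  have hI := integrable_sq_div_sub_one_pow hα0 hβ (α * (α + 1) / β ^ 2)
  have hA := le_measureReal_of_kurtosis_le (μ := gammaMeasure α β)
    (Z := fun x => x ^ 2 / (α * (α + 1) / β ^ 2) - 1) (by fun_prop) (by simpa using hI 1) (hI 2)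
    (hI 4) (Real.sqrt_pos.2 hv) (integral_sq_div_sub_one hα0 hβ)
    (by rw [Real.sq_sqrt hv.le]; exact integral_sq_div_sub_one_sq hα0 hβ)
    (by
      rw [show √(gammaSqRelVar α) ^ 4 = (√(gammaSqRelVar α) ^ 2) ^ 2 by ring, Real.sq_sqrt hv.le]
      exact integral_sq_div_sub_one_pow_four_le hα hβ)
  change _ ≤ (gammaMeasure α β).real (largeSizes α β) at hA
  set A := largeSizes α β
  have hp := gammaMeasure_real_Iio_one_le_of_le hα hβ hβ'
  have hp' : 1 / (10000 * α) ≤ 1 / 10000 := by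
    apply one_div_le_one_div_of_le <;> linarith
  have h := half_le_gammaMeasure_real_Ici hα hβ hβ'
  have hsub : (gammaMeasure α β).real A
      ≤ (gammaMeasure α β).real (Set.Ici 1 ∩ A) + (gammaMeasure α β).real (Set.Iio 1) := by
    refine (measureReal_mono fun x hx => ?_).trans (measureReal_union_le _ _)
    rcases le_or_gt 1 x with h1 | h1
    · exact Or.inl ⟨h1, hx⟩
    · exact Or.inr h1
  have hc : (truncGamma 1 α β).real A
      = ((gammaMeasure α β).real (Set.Ici 1))⁻¹ * (gammaMeasure α β).real (Set.Ici 1 ∩ A) := by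
    rw [measureReal_def, truncGamma, cond_apply measurableSet_Ici, ENNReal.toReal_mul,
      ENNReal.toReal_inv]
    rfl
  rw [hc]
  refine le_trans ?_ (le_mul_of_one_le_left measureReal_nonneg ?_)
  · linarith
  · exact (one_le_inv₀ (by linarith)).2 measureReal_le_one

/-- Column sizes at least `1` whose second sample moment is not much larger than that of the gamma
distribution, and a positive fraction of which exceeds the root mean square noticeably. -/
def typicalSizes (k : ℕ) (α β : ℝ) : Set (Fin k → ℝ) :=
  {s | (∀ j, 1 ≤ s j) ∧
    ∑ j, (s j ^ 2 / (α * (α + 1) / β ^ 2) - 1) ≤ k * (1 / 2500 * √(gammaSqRelVar α)) ∧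
    (k : ℝ) / 1000 ≤ ∑ j, Set.indicator (largeSizes α β) (fun _ => (1 : ℝ)) (s j)}

lemma measurableSet_typicalSizes (k : ℕ) (α β : ℝ) : MeasurableSet (typicalSizes k α β) := by
  refine MeasurableSet.inter (s₁ := {s : Fin k → ℝ | ∀ j, 1 ≤ s j}) ?_ (MeasurableSet.inter
    (s₁ := {s : Fin k → ℝ | ∑ j, (s j ^ 2 / (α * (α + 1) / β ^ 2) - 1)
      ≤ k * (1 / 2500 * √(gammaSqRelVar α))})
    (s₂ := {s : Fin k → ℝ | (k : ℝ) / 1000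
      ≤ ∑ j, Set.indicator (largeSizes α β) (fun _ => (1 : ℝ)) (s j)}) ?_ ?_)
  · exact measurableSet_setOfPred.2 (Measurable.forall fun j =>
      measurableSet_setOfPred.1 (measurableSet_le measurable_const (measurable_pi_apply j)))
  · exact measurableSet_le (by fun_prop) measurable_const
  · refine measurableSet_le measurable_const (Finset.measurable_fun_sum _ fun j _ => ?_)
    exact (measurable_const.indicator (measurableSet_largeSizes α β)).comp
      (measurable_pi_apply j)

lemma le_sizeLaw_typicalSizes {k : ℕ} (hk : 0 < k) (hα : 1 ≤ α) (hβ : 0 < β)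
    (hβ' : β ≤ 1 / 30000) {ε : ℝ} (hε : 0 < ε) (hkε : 10 ^ 8 / ε ≤ k) :
    ENNReal.ofReal (1 - ε) ≤ sizeLaw k α β (typicalSizes k α β) := by
  have hα0 := zero_lt_one.trans_le hα
  have hμ := isProbabilityMeasure_truncGamma hα hβ hβ'
  have hπ : IsProbabilityMeasure (sizeLaw k α β) := by unfold sizeLaw; infer_instance
  have hk' : (0 : ℝ) < k := Nat.cast_pos.2 hk
  have hv := gammaSqRelVar_pos hα0
  have hsv := Real.sqrt_pos.2 hv
  set A := largeSizes α β
  have hAm : MeasurableSet A := measurableSet_largeSizes α β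
  -- This absorbs the bias from truncation, of order `1/α`, into the tolerance for the second
  -- moment.
  have hsd : 1 / α ≤ √(gammaSqRelVar α) := by
    refine Real.le_sqrt_of_sq_le ?_
    rw [gammaSqRelVar, div_pow, div_le_div_iff₀ (by positivity) (by positivity)]
    nlinarith
  have hmean : ∫ x, (x ^ 2 / (α * (α + 1) / β ^ 2) - 1) ∂truncGamma 1 α β
      ≤ 1 / 5000 * √(gammaSqRelVar α) := by
    refine (integral_truncGamma_le hα hβ hβ').trans ?_
    have : 1 / (5000 * α) = 1 / 5000 * (1 / α) := by field_simp
    rw [this]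
    linarith
  have h1 := measureReal_pi_sum_lt_le hk (memLp_two_truncGamma hα hβ hβ' _) hmean
    (integral_sq_truncGamma_le hα hβ hβ') (x := 1 / 5000 * √(gammaSqRelVar α)) (by positivity)
  have hind : MemLp (Set.indicator A fun _ => (-1 : ℝ)) 2 (truncGamma 1 α β) :=
    (memLp_const _).indicator hAm
  have h2 := measureReal_pi_sum_lt_le hk hind (a := -(1 / 500)) (V := 1) (x := 1 / 1000)
    (by
      rw [integral_indicator_const _ hAm]
      have := le_truncGamma_real_largeSizes hα hβ hβ'
      simp only [smul_eq_mul]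
      linarith)
    (by
      refine (integral_mono (g := fun _ => (1 : ℝ)) hind.integrable_sq (integrable_const _)
        fun x => ?_).trans (by simp)
      by_cases hx : x ∈ A <;> simp [hx])
    (by norm_num)
  have h3 : ∀ᵐ s ∂sizeLaw k α β, ∀ j, 1 ≤ s j := by
    refine ae_all_iff.2 fun j => ?_
    have : ∀ᵐ x ∂truncGamma 1 α β, x ∈ Set.Ici (1 : ℝ) := ae_cond_mem measurableSet_Ici
    exact Measure.tendsto_eval_ae_ae.eventually this
  have h3' : (sizeLaw k α β).real {s | ¬ ∀ j, 1 ≤ s j} = 0 := by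
    rw [measureReal_def, ae_iff.1 h3]; rfl
  have hcompl : (sizeLaw k α β).real (typicalSizes k α β)ᶜ ≤ ε := by
    refine (measureReal_mono (fun s hs => ?_)).trans ((measureReal_union_le
      {s | ¬ ∀ j, 1 ≤ s j} _).trans (add_le_add h3'.le ((measureReal_union_le _ _).trans
      (add_le_add h1 h2)))) |>.trans ?_
    · by_contra hcon
      simp only [Set.mem_union, Set.mem_ofPred_eq, not_or, not_lt, not_not] at hcon
      refine hs ⟨hcon.1, ?_, ?_⟩
      · refine hcon.2.1.trans_eq ?_
        ring
      · have h := hcon.2.2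
        have e : ∑ j, Set.indicator A (fun _ => (-1 : ℝ)) (s j)
            = -∑ j, Set.indicator A (fun _ => (1 : ℝ)) (s j) := by
          rw [← Finset.sum_neg_distrib]
          refine Finset.sum_congr rfl fun j _ => ?_
          by_cases hx : s j ∈ A <;> simp [hx]
        rw [e] at h
        linarith
    -- The variance cancels against the squared tolerance, so the failure probability `(5·10⁷ +
    -- 10⁶)/k` does not depend on `α` or `β`.
    · rw [mul_pow, Real.sq_sqrt hv.le, zero_add]
      have e1 : 2 * gammaSqRelVar α / (k * ((1 / 5000) ^ 2 * gammaSqRelVar α))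
          = 5 * 10 ^ 7 / k := by
        field_simp; norm_num
      have e2 : (1 : ℝ) / (k * (1 / 1000) ^ 2) = 10 ^ 6 / k := by
        field_simp; norm_num
      rw [e1, e2, ← add_div, div_le_iff₀ hk']
      rw [div_le_iff₀ hε] at hkε
      linarith
  refine ENNReal.ofReal_le_of_le_toReal ?_
  have := probReal_compl_eq_one_sub (μ := sizeLaw k α β) (measurableSet_typicalSizes k α β)
  rw [← measureReal_def]
  linarith

end Sample

end SparseGram

/-! ### Singular value bounds for typical sizes, and the theorem -/

namespace SparseGram

lemma singularValue_bounds_of_mem_typicalSizes {k : ℕ} {α β : ℝ} (hα : 1 ≤ α) (hβ : 0 < β)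
    {s : Fin k → ℝ} (h : s ∈ typicalSizes k α β) {m : ℕ} {Ω : Type*} [MeasurableSpace Ω]
    {P : Measure Ω} [IsProbabilityMeasure P] {X : Ω → Matrix (Fin m) (Fin k) ℝ}
    (h1 : CondS1 P X s) (h2 : CondS2 P X s) (hL : (maxNonzero P X : ℝ) / m ≤ 1)
    (τ : Equiv.Perm (Fin k)) (hτ : Antitone fun i => expNormSq P X (τ i)) (i : Fin k) :
    (1 - (maxNonzero P X : ℝ) / m) * expNormSq P X (τ i) ≤ singularValue (expGram P X) i ∧
      singularValue (expGram P X) i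
        ≤ (1 + (k : ℝ) / (m * β) * √(α * (α + 1))) * expNormSq P X (τ i) := by
  obtain ⟨hs1, hsum, hcard⟩ := h
  have hs0 : ∀ j, 0 ≤ s j := fun j => zero_le_one.trans (hs1 j)
  have hsw := h2.le_expNormSq h1
  have hα0 := zero_lt_one.trans_le hα
  have hv := Real.sqrt_nonneg (gammaSqRelVar α)
  have hv5 : √(gammaSqRelVar α) ≤ 9 / 4 := by
    rw [Real.sqrt_le_left (by norm_num)]
    exact (gammaSqRelVar_le hα).trans (by norm_num)
  have hM : 0 < α * (α + 1) := by positivity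
  have hR2 : (√(α * (α + 1)) / β) ^ 2 = α * (α + 1) / β ^ 2 := by
    rw [div_pow, Real.sq_sqrt hM.le]
  have hM' : 0 < α * (α + 1) / β ^ 2 := by positivity
  refine ⟨h2.le_singularValue (fun j => (hs0 j).trans (hsw j)) hL τ hτ i, ?_⟩
  -- Here `δ = 100 δ'`, and the bound `9/4` on the relative standard deviation gives `δ' ≤ 9/10000`,
  -- hence `(1 + δ')² ≤ 1 + δ`.
  have := h2.singularValue_le_of_sum_sq_le hs0 hsw hL τ hτ i (R := √(α * (α + 1)) / β)
    (δ := 1 / 25 * √(gammaSqRelVar α)) (δ' := 1 / 2500 * √(gammaSqRelVar α))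
    (by positivity) (by linarith) (by nlinarith)
    (by
      rw [hR2]
      rw [Finset.sum_sub_distrib, ← Finset.sum_div] at hsum
      simp only [Finset.sum_const, Finset.card_univ, Fintype.card_fin, nsmul_eq_mul,
        mul_one] at hsum
      have := (div_le_iff₀ hM').1 (sub_le_iff_le_add.1 hsum)
      linarith)
    (by
      refine hcard.trans_eq ?_
      rw [Finset.card_filter, Nat.cast_sum]
      refine Finset.sum_congr rfl fun j _ => ?_
      have : s j ∈ largeSizes α β
          ↔ (√(α * (α + 1)) / β) ^ 2 * (1 + 1 / 25 * √(gammaSqRelVar α)) ≤ s j ^ 2 := by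
        rw [hR2, largeSizes, Set.mem_ofPred_eq, le_sub_iff_add_le, le_div_iff₀ hM']
        rw [add_comm, mul_comm]
      by_cases hj : s j ∈ largeSizes α β
      · rw [Set.indicator_of_mem hj, if_pos (this.1 hj), Nat.cast_one]
      · rw [Set.indicator_of_notMem hj, if_neg (mt this.2 hj), Nat.cast_zero])
  refine this.trans_eq ?_
  have : (k : ℝ) * (√(α * (α + 1)) / β) / m = k / (m * β) * √(α * (α + 1)) := by
    rw [mul_div_assoc', div_div, mul_comm β, mul_div_right_comm]
  rw [this]

end SparseGram

theorem corollary10 :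
    ∃ K η : ℝ, 0 ≤ K ∧ 0 < η ∧ ∀ ε : ℝ, 0 < ε → ∃ k₀ : ℕ, ∀ k : ℕ, k₀ ≤ k →
      ∀ α β : ℝ, 1 ≤ α → 0 < β → β ≤ 1 / √(k : ℝ) →
      ∃ S : Set (Fin k → ℝ), MeasurableSet S ∧
        ENNReal.ofReal (1 - ε) ≤ SparseGram.sizeLaw k α β S ∧
        ∀ s ∈ S, ∀ (m : ℕ) (Ω : Type*) [MeasurableSpace Ω] (P : Measure Ω) [IsProbabilityMeasure P]
          (X : Ω → Matrix (Fin m) (Fin k) ℝ),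
          SparseGram.CondS1 P X s → SparseGram.CondS2 P X s →
          1 / (k : ℝ) ≤ (SparseGram.maxNonzero P X : ℝ) / m →
          (SparseGram.maxNonzero P X : ℝ) / m ≤ η →
          ∀ τ : Equiv.Perm (Fin k), Antitone (fun i => SparseGram.expNormSq P X (τ i)) →
          ∀ i : Fin k,
            (1 + √(1 + 1 / α) + K * ((SparseGram.maxNonzero P X : ℝ) / m))⁻¹
                * SparseGram.expNormSq P X (τ i)
              ≤ SparseGram.singularValue (SparseGram.expGram P X) i ∧
            SparseGram.singularValue (SparseGram.expGram P X) i
              ≤ (1 + (k : ℝ) / (m * β) * √(α * (α + 1))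
                  + K * ((SparseGram.maxNonzero P X : ℝ) / m))
                * SparseGram.expNormSq P X (τ i) := by
  
  -- `K = 0` works: since `1 + √(1 + 1/α) ≥ 2`, the lower bound only needs `1 - L/m ≥ 1/2`. The
  -- threshold `10⁹` ensures `β ≤ 1/30000`, and `10⁸/ε` makes the failure probability at most `ε`.
  refine ⟨0, 1 / 2, le_rfl, by norm_num, fun ε hε => ⟨max (10 ^ 9) ⌈10 ^ 8 / ε⌉₊, ?_⟩⟩
  intro k hk α β hα hβ hβk
  have hk9 : (10 : ℝ) ^ 9 ≤ k := by exact_mod_cast (le_max_left _ _).trans hk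
  have hkε : 10 ^ 8 / ε ≤ k :=
    (Nat.le_ceil _).trans (by exact_mod_cast (le_max_right _ _).trans hk)
  have hk0 : 0 < k := by
    have : (0 : ℝ) < k := by linarith
    exact_mod_cast this
  have hβ' : β ≤ 1 / 30000 := by
    refine hβk.trans (one_div_le_one_div_of_le (by norm_num) (Real.le_sqrt_of_sq_le ?_))
    linarith
  refine ⟨SparseGram.typicalSizes k α β, SparseGram.measurableSet_typicalSizes k α β,
    SparseGram.le_sizeLaw_typicalSizes hk0 hα hβ hβ' hε hkε, ?_⟩
  intro s hs m Ω _ P _ X h1 h2 _ hL τ hτ i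
  obtain ⟨hlow, hup⟩ := SparseGram.singularValue_bounds_of_mem_typicalSizes hα hβ hs h1 h2
    (by linarith) τ hτ i
  have hw : 0 ≤ SparseGram.expNormSq P X (τ i) :=
    (zero_le_one.trans (hs.1 (τ i))).trans (h2.le_expNormSq h1 (τ i))
  simp only [zero_mul, add_zero]
  refine ⟨le_trans (mul_le_mul_of_nonneg_right ?_ hw) hlow, hup⟩
  have h3 : 1 ≤ √(1 + 1 / α) := by
    rw [Real.one_le_sqrt]
    have : 0 < 1 / α := by positivity
    linarith
  refine (inv_anti₀ (by norm_num : (0 : ℝ) < 2) (by linarith)).trans ?_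
  linarith
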